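/- Let $w\in F(X_1,\ldots,X_d)$ be a word in the free group on $X_1,\dots,X_d$, with reduced form $w=x_1^{\epsilon_1}\cdots x_\ell^{\epsilon_\ell}$, where $x_t\in\{X_1,\ldots,X_d\}$ and $\epsilon_t\in\{\pm1\}$. Definitions. For $1\le t\le \ell$ let $I_t(w):=x_1^{\epsilon_1}\cdots x_{t-1}^{\epsilon_{t-1}}$ if $\epsilon_t=1$ and $I_t(w):=x_1^{\epsilon_1}\cdots x_t^{\epsilon_t}$ if $\epsilon_t=-1$, and for $1\le i<j\le \ell$ let $\Delta_{i,j}(w):=I_i(w)^{-1}I_j(w)$. A variation of $w$ is a word $w'=y_1^{\epsilon_1}\cdots y_\ell^{\epsilon_\ell}$ obtained from $w$ by adding to the variable $x_t$ at each position $t$ some second index, so that $y_t=(x_t,f(t))$ with $f(t)\in\mathbb N$ arbitrary; it is an $(i,j)$-split variation if $x_i=x_j$ and $y_i\neq y_j$. A word $u$ in the variables $Y_1,\dots,Y_m$ is a coset identity over a nonabelian finite simple group $S$ if there are $\alpha_1,\ldots,\alpha_m\in\mathrm{Aut}(S)$ such that the word map of $u$ on $\mathrm{Aut}(S)$ is constant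 on $\prod_{k=1}^m S\alpha_k$ (with $S$ identified with $\mathrm{Inn}(S)$); $u$ is weakly multiplicity-bounding (WMB) if it is not a coset identity over any nonabelian finite simple group. A group $G$ satisfies the identity $u\equiv1$ if $u(g_1,\ldots,g_m)=1$ for all $g_1,\ldots,g_m\in G$. A finite group $H$ is semisimple if it has no nontrivial solvable normal subgroup; then conjugation embeds $H$ into $\mathrm{Aut}(\mathrm{Soc}(H))$, where $\mathrm{Soc}(H)\cong S_1^{n_1}\times\cdots\times S_r^{n_r}$ with $S_1,\ldots,S_r$ pairwise nonisomorphic nonabelian finite simple groups, and the permutation part of $H$ is $P(H):=H/(H\cap(\mathrm{Aut}(S_1)^{n_1}\times\cdots\times\mathrm{Aut}(S_r)^{n_r}))$, i.e. the quotient of $H$ by the subgroup of all elements that normalize each simple direct factor (equivalently, each minimal normal subgroup) of $\mathrm{Soc}(H)$. Theorem. Let $1\le i<j\le\ell$ with $x_i=x_j$, and assume that all $(i,j)$-split variations of $w$ are WMB. If a finite semisimple group $H$ satisfies the identity $w\equiv1$, then $P(H)$ satisfies the identity $\Delta_{i,j}(w)\equiv1$. In particular, there is a nontrivial word $v\in F(X_1,\ldots,X_d)$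 of length strictly smaller than $\ell$ such that $P(H)$ satisfies the identity $v\equiv1$. -/

import Mathlib

namespace SegmentIdentity

/-! ### Words

A word in `d` variables is an element `w` of `FreeGroup (Fin d)`. Its reduced form
`x_1^{ε_1} ⋯ x_ℓ^{ε_ℓ}` is the list `w.toWord`, whose positions are numbered from `0` here,
and whose entries are pairs (variable, sign), the sign `true` standing for the exponent `1` and
`false` for `-1`. Its length `ℓ` is `w.toWord.length`. -/

/-- The variable at position `t` of the reduced word `w`. -/
def letterVar {d : ℕ} (w : FreeGroup (Fin d)) (t : Fin w.toWord.length) : Fin d :=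
  (w.toWord.get t).1

/-- The sign of the exponent at position `t` of the reduced word `w`. -/
def letterSign {d : ℕ} (w : FreeGroup (Fin d)) (t : Fin w.toWord.length) : Bool :=
  (w.toWord.get t).2

/-- The initial segment of `w` attached to position `t`: everything strictly before position `t`
if the exponent there is `1`, everything up to and including position `t` if it is `-1`. -/
def initSegment {d : ℕ} (w : FreeGroup (Fin d)) (t : Fin w.toWord.length) : FreeGroup (Fin d) :=
  FreeGroup.mk (w.toWord.take (if letterSign w t then (t : ℕ) else (t : ℕ) + 1))

/-- The segment word `Δ_{i,j}(w) = I_i(w)⁻¹ I_j(w)`. -/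
def segment {d : ℕ} (w : FreeGroup (Fin d)) (i j : Fin w.toWord.length) : FreeGroup (Fin d) :=
  (initSegment w i)⁻¹ * initSegment w j

/-- The word obtained from `w` by adding to the variable at each position `t` the second
index `f t`. -/
def variation {d : ℕ} (w : FreeGroup (Fin d)) (f : Fin w.toWord.length → ℕ) :
    FreeGroup (Fin d × ℕ) :=
  FreeGroup.mk (List.ofFn fun t => ((letterVar w t, f t), letterSign w t))

/-- `w'` is an `(i,j)`-split variation of `w`: a variation of `w` in which the variables at the
positions `i` and `j` differ, although they agree in `w`. -/
def IsSplitVariation {d : ℕ} (w : FreeGroup (Fin d)) (i j : Fin w.toWord.length)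
    (w' : FreeGroup (Fin d × ℕ)) : Prop :=
  ∃ f : Fin w.toWord.length → ℕ, w' = variation w f ∧
    letterVar w i = letterVar w j ∧ (letterVar w i, f i) ≠ (letterVar w j, f j)

/-- The group `G` satisfies the identity `w ≡ 1`. -/
def SatisfiesIdentity {σ : Type*} (G : Type*) [Group G] (w : FreeGroup σ) : Prop :=
  ∀ g : σ → G, FreeGroup.lift g w = 1

/-- `w` is a coset identity over `S`: for some automorphisms `α_x` of `S`, the word map of `w` on
`Aut(S)` is constant on the product of the cosets `S α_x`, where `S` is identified with the group
of its inner automorphisms. -/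
def IsCosetIdentity {σ : Type*} (w : FreeGroup σ) (S : Type*) [Group S] : Prop :=
  ∃ α : σ → MulAut S, ∃ β : MulAut S,
    ∀ s : σ → S, FreeGroup.lift (fun x => MulAut.conj (s x) * α x) w = β

/-- `w` is weakly multiplicity-bounding: it is not a coset identity over any nonabelian finite
simple group. -/
def IsWMB {σ : Type*} (w : FreeGroup σ) : Prop :=
  ∀ (S : Type) [Group S] [Finite S] [IsSimpleGroup S],
    (∃ a b : S, a * b ≠ b * a) → ¬ IsCosetIdentity w S

/-! ### Semisimple groups and the permutation part -/

/-- A group without nontrivial solvable normal subgroups. -/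
def IsSemisimple (H : Type*) [Group H] : Prop :=
  ∀ N : Subgroup H, N.Normal → Group.IsSolvable N → N = ⊥

/-- `N` is a minimal normal subgroup of `G`. -/
def IsMinimalNormal {G : Type*} [Group G] (N : Subgroup G) : Prop :=
  Minimal (fun K : Subgroup G => K.Normal ∧ K ≠ ⊥) N

/-- The socle: the subgroup generated by all minimal normal subgroups. -/
def socle (G : Type*) [Group G] : Subgroup G :=
  sSup {N : Subgroup G | IsMinimalNormal N}

instance socle_normal (G : Type*) [Group G] : (socle G).Normal :=
  Subgroup.sSup_normal {N : Subgroup G | IsMinimalNormal N}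
    fun N (hN : IsMinimalNormal N) => hN.prop.1

theorem IsMinimalNormal.map_mulEquiv {G : Type*} [Group G] {N : Subgroup G}
    (hN : IsMinimalNormal N) (φ : MulAut G) : IsMinimalNormal (N.map φ.toMonoidHom) := by
  refine ⟨⟨hN.prop.1.map _ φ.surjective, fun h => hN.prop.2 ?_⟩, ?_⟩
  · exact (Subgroup.map_eq_bot_iff_of_injective _ φ.injective).1 h
  · rintro K ⟨hK, hK0⟩ hle
    have h1 : K.comap φ.toMonoidHom ≤ N := by
      have := Subgroup.comap_mono (f := φ.toMonoidHom) hle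
      rwa [Subgroup.comap_map_eq_self_of_injective φ.injective] at this
    have h2 : K.comap φ.toMonoidHom ≠ ⊥ := by
      intro h
      apply hK0
      rw [← Subgroup.map_comap_eq_self_of_surjective (f := φ.toMonoidHom) φ.surjective K, h,
        Subgroup.map_bot]
    have h3 := hN.le_of_le ⟨hK.comap _, h2⟩ h1
    exact Subgroup.map_le_iff_le_comap.2 h3

/-- The automorphisms of `N` that map each minimal normal subgroup of `N` onto itself. When
`N = S_1^{n_1} × ⋯ × S_r^{n_r}` with pairwise nonisomorphic nonabelian simple groups `S_k`, the
minimal normal subgroups of `N` are the `n_1 + ⋯ + n_r` simple direct factors, so that this is the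
base group `Aut(S_1)^{n_1} × ⋯ × Aut(S_r)^{n_r}` of
`Aut(N) = (Aut(S_1) ≀ Sym(n_1)) × ⋯ × (Aut(S_r) ≀ Sym(n_r))`. -/
def baseGroup (N : Type*) [Group N] : Subgroup (MulAut N) where
  carrier := {φ | ∀ T : Subgroup N, IsMinimalNormal T → T.map φ.toMonoidHom = T}
  one_mem' := fun T _ => Subgroup.map_id T
  mul_mem' := by
    intro φ ψ hφ hψ T hT
    have : T.map (φ * ψ).toMonoidHom = (T.map ψ.toMonoidHom).map φ.toMonoidHom := by
      rw [Subgroup.map_map]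
      rfl
    rw [this, hψ T hT, hφ T hT]
  inv_mem' := by
    intro φ hφ T hT
    have h : (T.map φ.toMonoidHom).map (φ⁻¹).toMonoidHom = T := by
      rw [Subgroup.map_map]
      convert Subgroup.map_id T
      ext x
      exact φ.symm_apply_apply x
    rwa [hφ T hT] at h

instance baseGroup_normal (N : Type*) [Group N] : (baseGroup N).Normal where
  conj_mem := by
    intro φ hφ ψ T hT
    have h1 := hφ _ (hT.map_mulEquiv ψ⁻¹)
    have h2 : T.map (ψ * φ * ψ⁻¹).toMonoidHom =
        ((T.map (ψ⁻¹).toMonoidHom).map φ.toMonoidHom).map ψ.toMonoidHom := by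
      rw [Subgroup.map_map, Subgroup.map_map]
      rfl
    rw [h2, h1, Subgroup.map_map]
    convert Subgroup.map_id T
    ext x
    exact ψ.apply_symm_apply x

/-- The elements of `H` that act by conjugation on the socle of `H` as elements of the base
group. For a finite semisimple `H` the conjugation action embeds `H` into `Aut(Soc(H))`, and this
subgroup is the intersection of `H` with the base group. -/
def permutationKernel (H : Type*) [Group H] : Subgroup H :=
  (baseGroup (socle H)).comap MulAut.conjNormal

instance permutationKernel_normal (H : Type*) [Group H] : (permutationKernel H).Normal :=
  Subgroup.Normal.comap inferInstance _

/-- The permutation part `P(H)` of `H`. -/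
abbrev PermutationPart (H : Type*) [Group H] : Type _ :=
  H ⧸ permutationKernel H

end SegmentIdentity

namespace SegmentIdentity

/-! ### Minimal normal subgroups of the socle -/

/-! Fix `g` in `H ^ d` and a simple factor `T` of the socle. When `w(g)` is computed as a
permutation of the orbit of `T` together with automorphisms between its members, the component at
`T` is a product in which position `t` contributes the component of its variable's value at the
factor `I_t(g)⁻¹ • T`. Multiplying each `g x` by socle elements leaves the permutation unchanged and
alters each component by an independent, arbitrary inner automorphism. Since `w` still evaluates to
1, the variation of `w` labelled by the factors reached is a coset identity over `T`
(`isCosetIdentity_variation`). If `I_i(g)⁻¹ • T` and `I_j(g)⁻¹ • T` differed, this variation would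
be `(i,j)`-split, against the WMB hypothesis (`smul_eq_smul_of_isWMB`). So `Δ_{i,j}(g)` fixes every
factor. -/

theorem IsMinimalNormal.disjoint {G : Type*} [Group G] {T T' : Subgroup G}
    (hT : IsMinimalNormal T) (hT' : IsMinimalNormal T') (hne : T ≠ T') : Disjoint T T' := by
  rw [disjoint_iff]
  by_contra h
  have := hT.prop.1
  have := hT'.prop.1
  have hn : (T ⊓ T').Normal ∧ T ⊓ T' ≠ ⊥ := ⟨inferInstance, h⟩
  exact hne (le_antisymm ((hT.le_of_le hn inf_le_left).trans inf_le_right)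
    ((hT'.le_of_le hn inf_le_right).trans inf_le_left))

theorem IsMinimalNormal.commute {G : Type*} [Group G] {T T' : Subgroup G}
    (hT : IsMinimalNormal T) (hT' : IsMinimalNormal T') (hne : T ≠ T') {x y : G} (hx : x ∈ T)
    (hy : y ∈ T') : Commute x y :=
  Subgroup.commute_of_normal_of_disjoint _ _ hT.prop.1 hT'.prop.1 (hT.disjoint hT' hne) _ _ hx hy

theorem exists_isMinimalNormal_le {G : Type*} [Group G] [Finite G] {K : Subgroup G}
    (hK : K.Normal) (hK' : K ≠ ⊥) : ∃ T ≤ K, IsMinimalNormal T :=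
  exists_minimal_le_of_wellFoundedLT (fun K : Subgroup G => K.Normal ∧ K ≠ ⊥) K ⟨hK, hK'⟩

instance socle_characteristic (G : Type*) [Group G] : (socle G).Characteristic := by
  rw [Subgroup.characteristic_iff_map_le]
  intro φ
  rw [socle, Subgroup.map_le_iff_le_comap]
  refine sSup_le fun T hT => ?_
  rw [← Subgroup.map_le_iff_le_comap]
  exact le_sSup (IsMinimalNormal.map_mulEquiv hT φ)

/-- A minimal normal subgroup `M` of `H` contains a minimal normal subgroup of `socle H`. Hence `M`
meets `socle (socle H)`, which is normal in `H` because it is characteristic in the socle, and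
minimality of `M` gives containment. -/
theorem socle_socle (H : Type*) [Group H] [Finite H] : socle (socle H) = ⊤ := by
  suffices h : socle H ≤ (socle (socle H)).map (socle H).subtype by
    rw [eq_top_iff]
    rintro ⟨x, hx⟩ -
    obtain ⟨y, hy, rfl⟩ := h hx
    exact hy
  refine sSup_le fun M (hM : IsMinimalNormal M) => ?_
  have hMle : M ≤ socle H := le_sSup hM
  have := hM.prop.1
  obtain ⟨T, hTM, hT⟩ := exists_isMinimalNormal_le (K := M.subgroupOf (socle H)) inferInstance
    (by
      rw [Ne, Subgroup.subgroupOf_eq_bot, disjoint_iff, inf_eq_left.2 hMle]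
      exact hM.prop.2)
  have hTs : T ≤ socle (socle H) := le_sSup hT
  refine (hM.le_of_le (y := M ⊓ (socle (socle H)).map (socle H).subtype) ⟨inferInstance, ?_⟩
    inf_le_left).trans inf_le_right
  intro h0
  apply hT.prop.2
  have hle : T.map (socle H).subtype ≤ M ⊓ (socle (socle H)).map (socle H).subtype :=
    le_inf (Subgroup.map_le_iff_le_comap.2 hTM) (Subgroup.map_mono hTs)
  rw [h0, le_bot_iff] at hle
  exact (Subgroup.map_eq_bot_iff_of_injective _ (Subgroup.subtype_injective _)).1 hle

theorem eq_top_of_isMinimalNormal_le {H : Type*} [Group H] [Finite H] {K : Subgroup (socle H)}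
    (h : ∀ T, IsMinimalNormal T → T ≤ K) : K = ⊤ := by
  rw [eq_top_iff, ← socle_socle H]
  exact sSup_le h

/-- A normal subgroup of `T` is normalized by `T` and centralized by the other minimal normal
subgroups. These generate the socle, so it is normal there and minimality of `T` applies. -/
theorem IsMinimalNormal.isSimpleGroup {H : Type*} [Group H] [Finite H] {T : Subgroup (socle H)}
    (hT : IsMinimalNormal T) : IsSimpleGroup T := by
  have : Nontrivial T := (Subgroup.nontrivial_iff_ne_bot T).2 hT.prop.2
  refine ⟨fun K hK => or_iff_not_imp_left.2 fun hK0 => ?_⟩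
  have hKT : K.map T.subtype ≤ T := Subgroup.map_subtype_le K
  have hnorm : (K.map T.subtype).Normal := by
    rw [← Subgroup.normalizer_eq_top_iff]
    refine eq_top_of_isMinimalNormal_le fun T' hT' => ?_
    by_cases hTT : T = T'
    · subst hTT
      intro x hx
      rw [Subgroup.mem_normalizer_iff]
      have key : ∀ y : T, ∀ k ∈ K.map T.subtype, (y : socle H) * k * (y : socle H)⁻¹ ∈
          K.map T.subtype := by
        rintro y _ ⟨k, hk, rfl⟩
        exact ⟨y * k * y⁻¹, hK.conj_mem k hk y, rfl⟩
      refine fun k => ⟨fun hk => key ⟨x, hx⟩ k hk, fun hk => ?_⟩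
      have := key ⟨x, hx⟩⁻¹ _ hk
      simpa [mul_assoc] using this
    · refine le_trans (fun x hx => ?_) (Subgroup.centralizer_le_normalizer _)
      exact Subgroup.mem_centralizer_iff.2 fun k hk => hT.commute hT' hTT (hKT hk) hx
  have h := hT.le_of_le ⟨hnorm, fun h => hK0
    ((Subgroup.map_eq_bot_iff_of_injective _ (Subgroup.subtype_injective _)).1 h)⟩ hKT
  rw [eq_top_iff]
  rintro ⟨x, hx⟩ -
  obtain ⟨k, hk, rfl⟩ := h hx
  exact hk

/-- An abelian `T` would be central in the socle, whose center is an abelian normal subgroup of `H`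
and therefore trivial. -/
theorem IsMinimalNormal.exists_not_commute {H : Type*} [Group H] [Finite H]
    (hH : IsSemisimple H) {T : Subgroup (socle H)} (hT : IsMinimalNormal T) :
    ∃ a b : T, a * b ≠ b * a := by
  by_contra! hcomm
  have hcent : Subgroup.centralizer (T : Set (socle H)) = ⊤ := by
    refine eq_top_of_isMinimalNormal_le fun T' hT' x hx => ?_
    refine Subgroup.mem_centralizer_iff.2 fun k hk => ?_
    by_cases hTT : T = T'
    · subst hTT
      exact congrArg Subtype.val (hcomm ⟨k, hk⟩ ⟨x, hx⟩)
    · exact hT.commute hT' hTT hk hx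
  have hTc : T ≤ Subgroup.center (socle H) := fun x hx => Subgroup.mem_center_iff.2 fun y =>
    (Subgroup.mem_centralizer_iff.1 (hcent ▸ Subgroup.mem_top y) x hx).symm
  have hbot := hH ((Subgroup.center (socle H)).map (socle H).subtype) inferInstance
    (Group.isSolvable_of_comm (by
      rintro ⟨_, x, hx, rfl⟩ ⟨_, y, hy, rfl⟩
      exact Subtype.ext (congrArg (socle H).subtype (Subgroup.mem_center_iff.1 hx y).symm)))
  rw [Subgroup.map_eq_bot_iff_of_injective _ (Subgroup.subtype_injective _)] at hbot
  exact hT.prop.2 (le_bot_iff.1 (hbot ▸ hTc))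

/-! ### Families of commuting subgroups permuted by a group -/

/-- A family of subgroups of `H`, indexed by an `H`-set `Ω`, which `H` permutes by conjugation in
accordance with its action on `Ω`, and whose members commute pairwise and act trivially on `Ω`. -/
structure CommutingFamily (H Ω : Type*) [Group H] [MulAction H Ω] where
  factor : Ω → Subgroup H
  conj_mem : ∀ (h : H) {ω : Ω} {x : H}, x ∈ factor ω → h * x * h⁻¹ ∈ factor (h • ω)
  commute : ∀ {ω ω' : Ω}, ω ≠ ω' → ∀ {x y : H}, x ∈ factor ω → y ∈ factor ω' → Commute x y
  smul_eq : ∀ {ω : Ω} {x : H}, x ∈ factor ω → ∀ ω' : Ω, x • ω' = ω'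

theorem lift_mk_cons {X G : Type*} [Group G] (q : X → G) (a : X × Bool) (L : List (X × Bool)) :
    FreeGroup.lift q (FreeGroup.mk (a :: L)) =
      cond a.2 (q a.1) (q a.1)⁻¹ * FreeGroup.lift q (FreeGroup.mk L) := by
  simp [FreeGroup.lift_mk]

namespace CommutingFamily

variable {H Ω : Type*} [Group H] [MulAction H Ω] (D : CommutingFamily H Ω)

/-- An element of `H` can be found whose conjugation action on each factor is that of a prescribed
element of the factor. -/
theorem exists_simultaneous [Finite Ω] (e : Ω → H) (he : ∀ ω, e ω ∈ D.factor ω) :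
    ∃ σ : H, (∀ ω : Ω, σ • ω = ω) ∧
      ∀ ω, ∀ y ∈ D.factor ω, σ * y * σ⁻¹ = e ω * y * (e ω)⁻¹ := by
  classical
  have := Fintype.ofFinite Ω
  suffices h : ∀ F : Finset Ω, ∃ σ : H, (∀ ω : Ω, σ • ω = ω) ∧
      ∀ ω, ∀ y ∈ D.factor ω, σ * y * σ⁻¹ = if ω ∈ F then e ω * y * (e ω)⁻¹ else y by
    simpa using h Finset.univ
  intro F
  induction F using Finset.induction_on with
  | empty => exact ⟨1, by simp⟩
  | insert a F ha ih =>
    obtain ⟨σ, h1, h2⟩ := ih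
    refine ⟨e a * σ, fun ω => by rw [mul_smul, h1, D.smul_eq (he a)], fun ω y hy => ?_⟩
    have hassoc : e a * σ * y * (e a * σ)⁻¹ = e a * (σ * y * σ⁻¹) * (e a)⁻¹ := by group
    rw [hassoc, h2 ω y hy]
    by_cases hωa : ω = a
    · subst hωa
      simp [ha]
    · have hmem : (if ω ∈ F then e ω * y * (e ω)⁻¹ else y) ∈ D.factor ω := by
        split_ifs
        · exact mul_mem (mul_mem (he ω) hy) (inv_mem (he ω))
        · exact hy
      rw [(D.commute (Ne.symm hωa) (he a) hmem).eq, mul_inv_cancel_right]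
      simp [hωa]

theorem stabilizer_le_normalizer (ω : Ω) :
    MulAction.stabilizer H ω ≤ Subgroup.normalizer (D.factor ω : Set H) := by
  have key : ∀ h ∈ MulAction.stabilizer H ω, ∀ x ∈ D.factor ω, h * x * h⁻¹ ∈ D.factor ω := by
    intro h hh x hx
    have := D.conj_mem h hx
    rwa [MulAction.mem_stabilizer_iff.1 hh] at this
  intro h hh
  rw [Subgroup.mem_normalizer_iff]
  refine fun x => ⟨key h hh x, fun hx => ?_⟩
  simpa [mul_assoc] using key h⁻¹ (inv_mem hh) _ hx

/-- The conjugation action of the stabilizer of `ω` on the factor at `ω`. -/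
def stabilizerHom (ω : Ω) : MulAction.stabilizer H ω →* MulAut (D.factor ω) :=
  (D.factor ω).normalizerMonoidHom.comp (Subgroup.inclusion (D.stabilizer_le_normalizer ω))

@[simp]
theorem coe_stabilizerHom_apply (ω : Ω) (h : MulAction.stabilizer H ω) (x : D.factor ω) :
    (D.stabilizerHom ω h x : H) = h * x * (h : H)⁻¹ := rfl

/-! ### The cocycle with values in the automorphisms of one reference factor -/

theorem transport_mem {ω₀ : Ω} {r : Ω → H} (hr : ∀ ω, r ω • ω₀ = ω) (k : H) (ω : Ω) :
    (r ω)⁻¹ * k * r (k⁻¹ • ω) ∈ MulAction.stabilizer H ω₀ := by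
  rw [MulAction.mem_stabilizer_iff, mul_smul, hr, mul_smul, smul_inv_smul, inv_smul_eq_iff, hr]

variable {ω₀ : Ω} {r : Ω → H} (hr : ∀ ω, r ω • ω₀ = ω)

/-- The automorphism of the factor at `ω₀` which conjugation by `k` from the factor at `k⁻¹ • ω`
to that at `ω` becomes after identifying all factors with that at `ω₀` through the
elements `r ω`. -/
def transport (k : H) (ω : Ω) : MulAut (D.factor ω₀) :=
  D.stabilizerHom ω₀ ⟨_, transport_mem hr k ω⟩

/-- Cocycle identity: the two occurrences of `r (k⁻¹ • ω)` cancel. -/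
theorem transport_mul (k l : H) (ω : Ω) :
    D.transport hr (k * l) ω = D.transport hr k ω * D.transport hr l (k⁻¹ • ω) := by
  rw [transport, transport, transport, ← map_mul]
  congr 1
  ext
  simp only [mul_inv_rev, mul_smul, Subgroup.coe_mul]
  group

theorem transport_one (ω : Ω) : D.transport hr 1 ω = 1 := by
  rw [transport, ← map_one (D.stabilizerHom ω₀)]
  congr 1
  ext
  simp

theorem transport_inv (k : H) (ω : Ω) :
    D.transport hr k⁻¹ ω = (D.transport hr k (k • ω))⁻¹ := by
  rw [eq_inv_iff_mul_eq_one]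
  have := D.transport_mul hr k⁻¹ k ω
  rwa [inv_mul_cancel, transport_one, inv_inv, eq_comm] at this

theorem transport_eq_conj {σ : H} {ω : Ω} (hσ : σ • ω = ω) (s : D.factor ω₀)
    (h : ∀ y ∈ D.factor ω, σ * y * σ⁻¹ =
      (r ω * s * (r ω)⁻¹) * y * (r ω * s * (r ω)⁻¹)⁻¹) :
    D.transport hr σ ω = MulAut.conj s := by
  have hσ' : σ⁻¹ • ω = ω := by rw [inv_smul_eq_iff, hσ]
  ext x
  have hx := D.conj_mem (r ω) x.2
  rw [hr] at hx
  have := h _ hx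
  simp only [transport, coe_stabilizerHom_apply, hσ', MulAut.conj_apply, Subgroup.coe_mul,
    Subgroup.coe_inv]
  calc (r ω)⁻¹ * σ * r ω * x * ((r ω)⁻¹ * σ * r ω)⁻¹
      = (r ω)⁻¹ * (σ * (r ω * x * (r ω)⁻¹) * σ⁻¹) * r ω := by group
    _ = _ := by rw [this]; group

/-- Evaluating a word letter by letter along the induced permutations of the factors. -/
theorem lift_mk_ofFn_eq_transport {X I : Type*} (e : Ω → I) (g k : X → H)
    (hgk : ∀ x (ω : Ω), k x • ω = g x • ω) (A : X × I → MulAut (D.factor ω₀))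
    (hA : ∀ x ω, A (x, e ω) = D.transport hr (k x) ω) (L : List (X × Bool)) (ω : Ω) :
    FreeGroup.lift A (FreeGroup.mk (List.ofFn fun t : Fin L.length =>
      (((L.get t).1, e ((FreeGroup.lift g (FreeGroup.mk (L.take
        (if (L.get t).2 then (t : ℕ) else (t : ℕ) + 1))))⁻¹ • ω)), (L.get t).2))) =
    D.transport hr (FreeGroup.lift k (FreeGroup.mk L)) ω := by
  have hgk' : ∀ x (ω : Ω), (k x)⁻¹ • ω = (g x)⁻¹ • ω := fun x ω => by
    rw [inv_smul_eq_iff, hgk, smul_inv_smul]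
  induction L generalizing ω with
  | nil => simp [transport_one]
  | cons a L ih =>
    obtain ⟨x, b⟩ := a
    have hif : ∀ (c : Bool) (t : ℕ), (if c then t + 1 else t + 1 + 1) =
        (if c then t else t + 1) + 1 := by intro c t; cases c <;> rfl
    have hletter : (cond b (k x) (k x)⁻¹)⁻¹ • ω = (cond b (g x) (g x)⁻¹)⁻¹ • ω := by
      cases b
      · simp [hgk]
      · exact hgk' x ω
    rw [lift_mk_cons, transport_mul, hletter, ← ih, List.ofFn_succ, lift_mk_cons]
    simp only [List.get_cons_zero, Fin.val_succ, hif, List.take_succ_cons,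
      lift_mk_cons, mul_inv_rev, mul_smul]
    congr 1
    -- For exponent `-1`, `transport_inv` takes the value of `k x` at `k x • ω`, one step further
    -- on; this is why the initial segment then includes the letter itself.
    cases b
    · simp [hA, transport_inv, hgk]
    · simp [hA, ← FreeGroup.one_eq_mk]

/-- If `H` satisfies `w ≡ 1`, then the variation of `w` that records at each position the factor
reached there is a coset identity over the factors. -/
theorem isCosetIdentity_variation [Finite Ω] [MulAction.IsPretransitive H Ω] {d : ℕ}
    (w : FreeGroup (Fin d)) (hw : SatisfiesIdentity H w) (g : Fin d → H) (ω₀ : Ω) {e : Ω → ℕ}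
    (he : Function.Injective e) :
    IsCosetIdentity
      (variation w fun t => e ((FreeGroup.lift g (initSegment w t))⁻¹ • ω₀)) (D.factor ω₀) := by
  have : Nonempty Ω := ⟨ω₀⟩
  choose r hr using fun ω : Ω => MulAction.exists_smul_eq H ω₀ ω
  -- `invFun e` recovers the factor from its label. Its values off the range of `e` are immaterial,
  -- as such labels do not occur in the variation.
  refine ⟨fun p => D.transport hr (g p.1) (Function.invFun e p.2), 1, fun s => ?_⟩
  have hmem : ∀ x ω, r ω * s (x, e ω) * (r ω)⁻¹ ∈ D.factor ω := fun x ω => by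
    have := D.conj_mem (r ω) (s (x, e ω)).2
    rwa [hr] at this
  -- A single `σ x` realizes the prescribed `s (x, e ω)` at all `ω` at once and fixes `Ω` pointwise,
  -- so replacing `g x` by `σ x * g x` keeps all labels.
  choose σ hσ₁ hσ₂ using fun x => D.exists_simultaneous _ (hmem x)
  have key := D.lift_mk_ofFn_eq_transport hr e g (fun x => σ x * g x)
    (fun x ω => by rw [mul_smul, hσ₁])
    (fun p => MulAut.conj (s p) * D.transport hr (g p.1) (Function.invFun e p.2))
    (fun x ω => by
      have hinv : (σ x)⁻¹ • ω = ω := by rw [inv_smul_eq_iff, hσ₁]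
      rw [transport_mul, hinv, D.transport_eq_conj hr (hσ₁ x ω) (s (x, e ω)) (hσ₂ x ω),
        Function.leftInverse_invFun he])
    w.toWord ω₀
  rw [FreeGroup.mk_toWord, hw, transport_one] at key
  exact key

end CommutingFamily

/-! ### Coset identities under isomorphism -/

theorem IsCosetIdentity.of_mulEquiv {X S S' : Type*} [Group S] [Group S'] {w : FreeGroup X}
    (h : IsCosetIdentity w S) (φ : S ≃* S') : IsCosetIdentity w S' := by
  obtain ⟨α, β, h⟩ := h
  refine ⟨fun x => MulAut.congr φ (α x), MulAut.congr φ β, fun s => ?_⟩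
  rw [← h fun x => φ.symm (s x), ← MulEquiv.coe_toMonoidHom, ← MonoidHom.comp_apply]
  congr 1
  ext x y
  simp

/-- `IsWMB` quantifies over `Type` only, while the factors live in the universe of `H`; being
finite, they have copies in `Type`. -/
theorem IsWMB.not_isCosetIdentity {X : Type*} {w : FreeGroup X} (hw : IsWMB w) (S : Type*)
    [Group S] [Finite S] [IsSimpleGroup S] (hS : ∃ a b : S, a * b ≠ b * a) :
    ¬ IsCosetIdentity w S := by
  intro h
  let φ : Shrink.{0} S ≃* S := Shrink.mulEquiv
  have : Finite (Shrink.{0} S) := Finite.of_equiv S φ.symm.toEquiv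
  have : IsSimpleGroup (Shrink.{0} S) := φ.isSimpleGroup
  obtain ⟨a, b, hab⟩ := hS
  refine hw (Shrink.{0} S) ⟨φ.symm a, φ.symm b, fun hc => hab ?_⟩ (h.of_mulEquiv φ.symm)
  simpa [← map_mul] using hc

/-! ### The permutation part -/

section Socle

variable (H : Type*) [Group H]

/-- The conjugation action on the subgroups of the socle. -/
abbrev socleAction : MulAction H (Subgroup (socle H)) where
  smul h T := T.map (MulAut.conjNormal h : MulAut (socle H)).toMonoidHom
  one_smul T := by
    change T.map (MulAut.conjNormal 1 : MulAut (socle H)).toMonoidHom = T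
    rw [map_one]
    exact Subgroup.map_id T
  mul_smul h k T := by
    change T.map (MulAut.conjNormal (h * k) : MulAut (socle H)).toMonoidHom =
      (T.map (MulAut.conjNormal k : MulAut (socle H)).toMonoidHom).map
        (MulAut.conjNormal h : MulAut (socle H)).toMonoidHom
    rw [map_mul, Subgroup.map_map]
    rfl

attribute [local instance] socleAction

variable {H}

theorem socleAction_smul_def (h : H) (T : Subgroup (socle H)) :
    h • T = T.map (MulAut.conjNormal h : MulAut (socle H)).toMonoidHom := rfl

theorem smul_eq_of_mem_socle {x : H} (hx : x ∈ socle H) {T : Subgroup (socle H)} (hT : T.Normal) :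
    x • T = T := by
  have : (MulAut.conjNormal x : MulAut (socle H)) = MulAut.conj ⟨x, hx⟩ :=
    MulAut.conjNormal_val (h := ⟨x, hx⟩)
  rw [socleAction_smul_def, this]
  ext y
  constructor
  · rintro ⟨z, hz, rfl⟩
    exact hT.conj_mem z hz _
  · intro hy
    exact ⟨_, hT.conj_mem' y hy ⟨x, hx⟩, by simp [mul_assoc]⟩

theorem IsMinimalNormal.of_mem_orbit {T T' : Subgroup (socle H)} (hT : IsMinimalNormal T)
    (hT' : T' ∈ MulAction.orbit H T) : IsMinimalNormal T' := by
  obtain ⟨h, rfl⟩ := hT'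
  exact hT.map_mulEquiv _

/-- The conjugates in `H` of a minimal normal subgroup of the socle. -/
def conjugateFamily {T : Subgroup (socle H)} (hT : IsMinimalNormal T) :
    CommutingFamily H (MulAction.orbit H T) where
  factor ω := ω.1.map (socle H).subtype
  conj_mem := by
    rintro h ω _ ⟨x, hx, rfl⟩
    exact ⟨MulAut.conjNormal h x, ⟨x, hx, rfl⟩, rfl⟩
  commute := by
    rintro ω ω' hne _ _ ⟨x, hx, rfl⟩ ⟨y, hy, rfl⟩
    exact ((hT.of_mem_orbit ω.2).commute (hT.of_mem_orbit ω'.2)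
      (fun h => hne (Subtype.ext h)) hx hy).map _
  smul_eq := by
    rintro ω _ ⟨x, hx, rfl⟩ ω'
    exact Subtype.ext (smul_eq_of_mem_socle x.2 (hT.of_mem_orbit ω'.2).prop.1)

theorem smul_eq_smul_of_isWMB [Finite H] (hH : IsSemisimple H) {d : ℕ} {w : FreeGroup (Fin d)}
    {i j : Fin w.toWord.length} (hx : letterVar w i = letterVar w j)
    (hwmb : ∀ w', IsSplitVariation w i j w' → IsWMB w') (hw : SatisfiesIdentity H w)
    (g : Fin d → H) {T : Subgroup (socle H)} (hT : IsMinimalNormal T) :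
    (FreeGroup.lift g (initSegment w i))⁻¹ • T = (FreeGroup.lift g (initSegment w j))⁻¹ • T := by
  by_contra hne
  let ω₀ : MulAction.orbit H T := ⟨T, MulAction.mem_orbit_self T⟩
  obtain ⟨n, ⟨e⟩⟩ := Finite.exists_equiv_fin (MulAction.orbit H T)
  have he : Function.Injective fun ω => (e ω : ℕ) := Fin.val_injective.comp e.injective
  let φ : T ≃* (conjugateFamily hT).factor ω₀ :=
    T.equivMapOfInjective _ (Subgroup.subtype_injective _)
  have := hT.isSimpleGroup
  refine (hwmb _ ⟨_, rfl, hx, fun h => hne ?_⟩).not_isCosetIdentity T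
    (hT.exists_not_commute hH)
    (((conjugateFamily hT).isCosetIdentity_variation w hw g ω₀ he).of_mulEquiv φ.symm)
  exact congrArg Subtype.val (he (Prod.ext_iff.1 h).2)

theorem satisfiesIdentity_segment [Finite H] (hH : IsSemisimple H) {d : ℕ}
    {w : FreeGroup (Fin d)} {i j : Fin w.toWord.length} (hx : letterVar w i = letterVar w j)
    (hwmb : ∀ w', IsSplitVariation w i j w' → IsWMB w') (hw : SatisfiesIdentity H w) :
    SatisfiesIdentity (PermutationPart H) (segment w i j) := by
  intro q
  choose g hg using fun x => QuotientGroup.mk'_surjective (permutationKernel H) (q x)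
  have hlift : FreeGroup.lift q =
      (QuotientGroup.mk' (permutationKernel H)).comp (FreeGroup.lift g) := by
    ext x
    simpa using (hg x).symm
  rw [hlift, MonoidHom.comp_apply, QuotientGroup.mk'_apply, QuotientGroup.eq_one_iff]
  intro T hT
  change FreeGroup.lift g (segment w i j) • T = T
  -- Taking the factor `I_j(g) • T` turns the equality into `I_i(g)⁻¹ • I_j(g) • T = T`.
  have h := smul_eq_smul_of_isWMB hH hx hwmb hw g
    (T := FreeGroup.lift g (initSegment w j) • T) (hT.map_mulEquiv _)
  rw [inv_smul_smul] at h
  rw [segment, map_mul, map_inv, mul_smul, h]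

end Socle

/-! ### A shorter identity -/

theorem toWord_mk_drop_take {X : Type*} [DecidableEq X] (w : FreeGroup X) (a b : ℕ) :
    (FreeGroup.mk ((w.toWord.take b).drop a)).toWord = (w.toWord.take b).drop a := by
  have h : FreeGroup.IsReduced w.toWord := FreeGroup.isReduced_toWord
  have h' : FreeGroup.IsReduced ((w.toWord.take b).drop a) := (List.IsChain.take h b).drop a
  rw [FreeGroup.toWord_mk, h'.reduce_eq]

theorem segment_eq_mk {d : ℕ} (w : FreeGroup (Fin d)) {i j : Fin w.toWord.length} (hij : i < j) :
    segment w i j = FreeGroup.mk ((w.toWord.take (if letterSign w j then (j : ℕ) else j + 1)).drop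
      (if letterSign w i then (i : ℕ) else i + 1)) := by
  have hij' : (i : ℕ) < j := hij
  rw [segment, inv_mul_eq_iff_eq_mul, initSegment, initSegment, FreeGroup.mul_mk]
  set a := if letterSign w i then (i : ℕ) else i + 1 with ha
  set b := if letterSign w j then (j : ℕ) else j + 1 with hb
  have hab : a ≤ b := by rw [ha, hb]; split_ifs <;> omega
  have h := List.take_append_drop a (w.toWord.take b)
  rw [List.take_take, min_eq_left hab] at h
  rw [h]

/-- Adjacent letters in the same variable with opposite signs would cancel. This keeps the subword
chosen for the shorter identity nonempty when the signs at `i` and `j` differ. -/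
theorem letterSign_eq_of_succ_eq {d : ℕ} {w : FreeGroup (Fin d)} {i j : Fin w.toWord.length}
    (hij : (i : ℕ) + 1 = j) (hx : letterVar w i = letterVar w j) :
    letterSign w i = letterSign w j := by
  have h := List.isChain_iff_getElem.1 (FreeGroup.isReduced_toWord (x := w)) i (by omega)
  have hj : w.toWord[(i : ℕ) + 1]'(by omega) = w.toWord.get j := by simp [hij]
  rw [hj] at h
  exact h hx

theorem SatisfiesIdentity.of_conj {X G : Type*} [Group G] {u v : FreeGroup X}
    (h : SatisfiesIdentity G (u * v * u⁻¹)) : SatisfiesIdentity G v := fun g => by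
  simpa using h g

/-- The segment is a contiguous subword of `w`, hence reduced, and it omits the letter at `i` or at
`j` unless the signs there are `+` and `-`; in that case its two end letters are mutually inverse
and can be conjugated away. -/
theorem exists_shorter_of_satisfiesIdentity_segment {G : Type*} [Group G] {d : ℕ}
    {w : FreeGroup (Fin d)} {i j : Fin w.toWord.length} (hij : i < j)
    (hx : letterVar w i = letterVar w j) (h : SatisfiesIdentity G (segment w i j)) :
    ∃ v : FreeGroup (Fin d), v ≠ 1 ∧ v.toWord.length < w.toWord.length ∧
      SatisfiesIdentity G v := by
  have hij' : (i : ℕ) < j := hij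
  have hj := j.2
  suffices hs : ∃ a b : ℕ, a < b ∧ b ≤ w.toWord.length ∧ b - a < w.toWord.length ∧
      SatisfiesIdentity G (FreeGroup.mk ((w.toWord.take b).drop a)) by
    obtain ⟨a, b, hab, hb, hlen, hv⟩ := hs
    have hword := toWord_mk_drop_take w a b
    have hlength : ((w.toWord.take b).drop a).length = b - a := by simp [hb]
    refine ⟨_, fun h1 => ?_, by rwa [hword, hlength], hv⟩
    rw [h1, FreeGroup.toWord_one] at hword
    rw [← hword, List.length_nil] at hlength
    omega
  have hsucc := fun hij => letterSign_eq_of_succ_eq (i := i) (j := j) hij hx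
  have hseg := segment_eq_mk w hij
  cases hi : letterSign w i <;> cases hj' : letterSign w j <;>
    simp only [hi, hj', Bool.false_eq_true, if_true, if_false, reduceCtorEq, imp_false]
      at hseg hsucc
  · exact ⟨i + 1, j + 1, by omega, by omega, by omega, hseg ▸ h⟩
  · exact ⟨i + 1, j, by omega, by omega, by omega, hseg ▸ h⟩
  -- Signs `+` and `-`: the segment contains both end letters and may be all of `w`, so it is
  -- replaced by its interior.
  · refine ⟨i + 1, j, by omega, by omega, by omega, ?_⟩
    refine SatisfiesIdentity.of_conj (u := FreeGroup.of (letterVar w i)) ?_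
    convert h using 1
    have hi' : w.toWord[(i : ℕ)] = (letterVar w i, true) := Prod.ext rfl hi
    have hj'' : w.toWord[(j : ℕ)] = (letterVar w i, false) := Prod.ext hx.symm hj'
    rw [hseg, List.take_succ_eq_append_getElem hj, List.drop_append_of_le_length (by simp; omega),
      List.drop_eq_getElem_cons (i := i) (by simp; omega), List.getElem_take, hi', hj'',
      FreeGroup.of, FreeGroup.inv_mk, FreeGroup.mul_mk, FreeGroup.mul_mk]
    simp [FreeGroup.invRev]
  · exact ⟨i, j, by omega, by omega, by omega, hseg ▸ h⟩
end SegmentIdentity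

theorem theorem5p4 {d : ℕ} (w : FreeGroup (Fin d)) (i j : Fin w.toWord.length) (hij : i < j)
    (hx : SegmentIdentity.letterVar w i = SegmentIdentity.letterVar w j)
    (hwmb : ∀ w' : FreeGroup (Fin d × ℕ),
      SegmentIdentity.IsSplitVariation w i j w' → SegmentIdentity.IsWMB w')
    (H : Type*) [Group H] [Finite H] (hH : SegmentIdentity.IsSemisimple H)
    (hw : SegmentIdentity.SatisfiesIdentity H w) :
    SegmentIdentity.SatisfiesIdentity (SegmentIdentity.PermutationPart H)
        (SegmentIdentity.segment w i j) ∧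
      ∃ v : FreeGroup (Fin d), v ≠ 1 ∧ v.toWord.length < w.toWord.length ∧
        SegmentIdentity.SatisfiesIdentity (SegmentIdentity.PermutationPart H) v :=
  have h := SegmentIdentity.satisfiesIdentity_segment hH hx hwmb hw
  ⟨h, SegmentIdentity.exists_shorter_of_satisfiesIdentity_segment hij hx h⟩
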